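/- Let $\varphi_0,\varphi_1,\dots$ be a standard effective numbering of the partial computable functions on $\mathbb N$; $e$ is an *index* of a total function $f$ if $\varphi_e=f$. Finite tuples, finite sets, rational numbers and elements of $\mathbb Q(i)$ are coded effectively by natural numbers. Let $(\mathfrak p_n)_{n\in\mathbb N}$ be an effective enumeration of the rational $*$-polynomials, that is, the noncommutative $*$-polynomials without constant term over $\mathbb Q(i)$ in the indeterminates $x_0,x_1,\dots$ For a compact Polish space $X$ let $C^*(X)$ be the $C^*$-algebra of continuous functions $X\to\mathbb C$. A *presentation* $C^*(X)^\#=(C^*(X),(u_n)_n)$ is a sequence of vectors generating $C^*(X)$ as a $C^*$-algebra; $\mathfrak p_n[C^*(X)^\#]$ is the result of substituting $u_j$ for $x_j$ in $\mathfrak p_n$. A *name* of it is a function $f\in\mathbb N^{\mathbb N}$ that enumerates (codes of) its diagram $$\{(r,j,r') : r,r'\in\mathbb Q\cap(0,\infty),\ r<\|\mathfrak p_j[C^*(X)^\#]\|<r'\}.$$ A *presentation* $X^\#=(X,d,(p_n)_n)$ of $X$ consists of a complete metric $d$ inducing the topology of $X$ and a dense sequence $(p_n)_n$ in $X$. A *name*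 of it is a function that enumerates (codes of) $\{(r,j,k,r') : r,r'\in\mathbb Q,\ r<d(p_j,p_k)<r'\}$. A *total boundedness function* of $X^\#$ is a function $f\in\mathbb N^{\mathbb N}$ such that for each $j$, $f(j)$ codes a finite $F\subseteq\mathbb N$ with $X=\bigcup_{k\in F}B(p_k;2^{-j})$. An *index* of a presentation is an index of a name of it. A *name* of a point $x$ of a metric space $(M,d)$ with special points $(s_n)_n$ is an $h\in\mathbb N^{\mathbb N}$ with $d(s_{h(k)},x)<2^{-k}$ for all $k$. A map between two such spaces is *computable*, with index $c$, if the oracle machine with index $c$ computes, from any name of any point $x$, a name of the image of $x$. Equip $C^*(X)\times X$ with the metric $\max\{\|f-g\|,d(p,q)\}$ and the special points $(\mathfrak p_m[C^*(X)^\#],p_n)$, $m,n\in\mathbb N$ (enumerated by an effective bijection $\mathbb N\to\mathbb N^2$), and $\mathbb C$ with its usual metric and the special points $\mathbb Q(i)$. $C^*(X)^\#$ is *evaluative* over $X^\#$ if the evaluation map $(f,p)\mapsto f(p)$ is computable from $C^*(X)\times X$ to $\mathbb C$. **Corollary.** There is a nonempty compact Polish space $X$ for which there is no algorithm (partial computable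 function) that, given any index $e$ of any presentation $C^*(X)^\#$ of $C^*(X)$, produces an index of a presentation $X^\#$ of $X$ and an index of a total boundedness function of $X^\#$ so that $C^*(X)^\#$ is evaluative over $X^\#$ uniformly in $e$, i.e. together with an index of the evaluation map as a computable map from $C^*(X)\times X$ to $\mathbb C$. (An index determines a presentation only up to isometric isomorphism: the requirement on the algorithm is that for every $e$ and every presentation $C^*(X)^\#$ with index $e$, it halts on $e$ and outputs $a,b,c$ such that for some presentation $X^\#$ with index $a$, $b$ is an index of a total boundedness function of $X^\#$ and $c$ is an index of the evaluation map.) -/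

import Mathlib

namespace EvalPres

/-! ### Indices of computable functions and codings -/

/-- The standard effective numbering `φ₀, φ₁, …` of the partial computable functions on `ℕ`. -/
def phi (e : ℕ) : ℕ →. ℕ := (Denumerable.ofNat Nat.Partrec.Code e).eval

/-- `e` is an index of the total function `f`. -/
def IsIndexOf (e : ℕ) (f : ℕ → ℕ) : Prop := ∀ n, f n ∈ phi e n

/-- An effective numbering of the rational numbers (with repetitions). -/
def ratOfNat (n : ℕ) : ℚ :=
  ((n.unpair.1.unpair.1 : ℚ) - (n.unpair.1.unpair.2 : ℚ)) / ((n.unpair.2 : ℚ) + 1)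

/-- An effective numbering of `ℚ(i)`: the special points of the standard presentation of `ℂ`. -/
noncomputable def cplxOfNat (n : ℕ) : ℂ :=
  (((ratOfNat n.unpair.1 : ℚ) : ℝ) : ℂ) + (((ratOfNat n.unpair.2 : ℚ) : ℝ) : ℂ) * Complex.I

/-- The triple `(r, j, r')` coded by a natural number. -/
def tripleOfNat (n : ℕ) : ℚ × ℕ × ℚ :=
  (ratOfNat n.unpair.1, n.unpair.2.unpair.1, ratOfNat n.unpair.2.unpair.2)

/-- The quadruple `(r, j, k, r')` coded by a natural number. -/
def quadOfNat (n : ℕ) : ℚ × ℕ × ℕ × ℚ :=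
  (ratOfNat n.unpair.1, n.unpair.2.unpair.1, n.unpair.2.unpair.2.unpair.1,
    ratOfNat n.unpair.2.unpair.2.unpair.2)

/-! ### Rational `*`-polynomials and presentations of C*-algebras -/

/-- A letter: `Sum.inl j` is the indeterminate `x_j`, and `Sum.inr j` is its adjoint `x_j*`. -/
abbrev Letter : Type := ℕ ⊕ ℕ

/-- A rational `*`-polynomial in the (noncommuting) indeterminates `x_0, x_1, …`: a finite sum of
monomials `(c, l, w)`, that is, the coefficient `cplxOfNat c ∈ ℚ(i)` times the nonempty word
`l :: w`. There is no constant term, since C*-algebras need not have a unit. -/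
abbrev RatStarPoly : Type := List (ℕ × Letter × List Letter)

/-- The effective enumeration `(𝔭_n)` of the rational `*`-polynomials. -/
def polyOfNat (n : ℕ) : RatStarPoly := Denumerable.ofNat RatStarPoly n

section CStar

variable {A : Type*} [NonUnitalCStarAlgebra A]

/-- The value of a letter when `u j` is substituted for `x_j`. -/
def letterEval (u : ℕ → A) : Letter → A
  | Sum.inl j => u j
  | Sum.inr j => star (u j)

/-- The value of the word `l :: w` when `u j` is substituted for `x_j`. -/
def wordEval (u : ℕ → A) (l : Letter) (w : List Letter) : A :=
  (w.map (letterEval u)).foldl (fun a b => a * b) (letterEval u l)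

/-- The value of a rational `*`-polynomial when `u j` is substituted for `x_j`. -/
noncomputable def polyEval (u : ℕ → A) (p : RatStarPoly) : A :=
  (p.map fun m => cplxOfNat m.1 • wordEval u m.2.1 m.2.2).sum

end CStar

/-- A presentation `A^# = (A, (u_n))` of a C*-algebra `A`: a sequence of distinguished vectors
that generates `A` as a C*-algebra. -/
structure CStarPresentation (A : Type*) [NonUnitalCStarAlgebra A] where
  /-- the distinguished vectors -/
  vec : ℕ → A
  dense_adjoin : Dense (NonUnitalStarAlgebra.adjoin ℂ (Set.range vec) : Set A)

namespace CStarPresentation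

variable {A : Type*} [NonUnitalCStarAlgebra A]

/-- The `n`-th rational vector `𝔭_n[A^#]`. -/
noncomputable def ratVec (P : CStarPresentation A) (n : ℕ) : A := polyEval P.vec (polyOfNat n)

/-- The diagram of a presentation of a C*-algebra. -/
def diagram (P : CStarPresentation A) : Set (ℚ × ℕ × ℚ) :=
  {t | 0 < t.1 ∧ 0 < t.2.2 ∧ (t.1 : ℝ) < ‖P.ratVec t.2.1‖ ∧ ‖P.ratVec t.2.1‖ < (t.2.2 : ℝ)}

/-- `f` is a name of the presentation: it enumerates (codes of) the diagram. -/
def IsName (P : CStarPresentation A) (f : ℕ → ℕ) : Prop :=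
  P.diagram = Set.range fun k => tripleOfNat (f k)

/-- `e` is an index of the presentation: an index of a (computable) name of it. -/
def HasIndex (P : CStarPresentation A) (e : ℕ) : Prop := ∃ f, IsIndexOf e f ∧ P.IsName f

end CStarPresentation

/-! ### Presentations of Polish spaces -/

/-- A presentation `X^# = (X, d, (p_n))` of a Polish space `X`: a complete metric `d` inducing the
topology of `X` and a dense sequence of distinguished points. -/
structure SpacePresentation (X : Type*) [t : TopologicalSpace X] where
  metric : MetricSpace X
  topology_eq : metric.toUniformSpace.toTopologicalSpace = t
  complete : @CompleteSpace X metric.toUniformSpace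
  /-- the distinguished points -/
  pt : ℕ → X
  dense_pt : DenseRange pt

namespace SpacePresentation

variable {X : Type*} [TopologicalSpace X]

/-- The metric of the presentation. -/
def d (Q : SpacePresentation X) (x y : X) : ℝ := Q.metric.dist x y

/-- The diagram of a presentation of a Polish space. -/
def diagram (Q : SpacePresentation X) : Set (ℚ × ℕ × ℕ × ℚ) :=
  {t | (t.1 : ℝ) < Q.d (Q.pt t.2.1) (Q.pt t.2.2.1) ∧
    Q.d (Q.pt t.2.1) (Q.pt t.2.2.1) < (t.2.2.2 : ℝ)}

/-- `f` is a name of the presentation: it enumerates (codes of) the diagram. -/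
def IsName (Q : SpacePresentation X) (f : ℕ → ℕ) : Prop :=
  Q.diagram = Set.range fun k => quadOfNat (f k)

/-- `e` is an index of the presentation: an index of a (computable) name of it. -/
def HasIndex (Q : SpacePresentation X) (e : ℕ) : Prop := ∃ f, IsIndexOf e f ∧ Q.IsName f

/-- `f` is a total boundedness function of the presentation: for every `j`, `f j` codes a (list
enumerating a) finite set `F ⊆ ℕ` such that the balls `B(p_k; 2^{-j})`, `k ∈ F`, cover `X`. -/
def IsTotalBoundednessFunction (Q : SpacePresentation X) (f : ℕ → ℕ) : Prop :=
  ∀ j : ℕ, ∀ x : X, ∃ k ∈ Denumerable.ofNat (List ℕ) (f j), Q.d x (Q.pt k) < (2 : ℝ)⁻¹ ^ j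

end SpacePresentation

/-! ### Computable maps between presented metric spaces -/

/-- `h` is a name of the point `x` of the metric space `(M, d)` with special points `(s_n)`. -/
def IsPointName {M : Type*} (d : M → M → ℝ) (s : ℕ → M) (x : M) (h : ℕ → ℕ) : Prop :=
  ∀ k : ℕ, d (s (h k)) x < (2 : ℝ)⁻¹ ^ k

/-- The finite initial segment of length `n` of `h`. -/
def initSeg (h : ℕ → ℕ) (n : ℕ) : List ℕ := (List.range n).map h

/-- `c` is an index of the map `F` from `(M, d, (s_n))` to `(M', d', (s'_n))`: from any name `h` of
any point `x` the machine `φ_c` computes a name of `F x`. Access to the oracle `h` is modelled by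
finite initial segments: on input `k` and a long enough initial segment of `h` the machine halts,
and whenever it halts on an initial segment of `h`, its output is the number of a special point
within `2^{-k}` of `F x`. -/
def IsMapIndex {M M' : Type*} (d : M → M → ℝ) (s : ℕ → M) (d' : M' → M' → ℝ) (s' : ℕ → M')
    (F : M → M') (c : ℕ) : Prop :=
  ∀ (x : M) (h : ℕ → ℕ), IsPointName d s x h → ∀ k : ℕ,
    (∃ n : ℕ, (phi c (Nat.pair k (Encodable.encode (initSeg h n)))).Dom) ∧
    ∀ n : ℕ, ∀ w ∈ phi c (Nat.pair k (Encodable.encode (initSeg h n))),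
      d' (s' w) (F x) < (2 : ℝ)⁻¹ ^ k

/-! ### Evaluative presentations -/

section Evaluation

variable {X : Type*} [TopologicalSpace X] [CompactSpace X]

/-- The metric of the product `(C*(X) × X)^#`. -/
noncomputable def prodDist (Q : SpacePresentation X) (a b : C(X, ℂ) × X) : ℝ :=
  max ‖a.1 - b.1‖ (Q.d a.2 b.2)

/-- The special points of the product `(C*(X) × X)^#`. -/
noncomputable def prodPt (P : CStarPresentation C(X, ℂ)) (Q : SpacePresentation X) (n : ℕ) :
    C(X, ℂ) × X :=
  (P.ratVec n.unpair.1, Q.pt n.unpair.2)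

/-- `c` is an index of the evaluation functional `(f, p) ↦ f p`, as a computable map
from `(C*(X) × X)^#` to `ℂ`. -/
def IsEvaluationIndex (P : CStarPresentation C(X, ℂ)) (Q : SpacePresentation X) (c : ℕ) : Prop :=
  IsMapIndex (prodDist Q) (prodPt P Q) (fun z w : ℂ => dist z w) cplxOfNat
    (fun a : C(X, ℂ) × X => a.1 a.2) c

/-- `C*(X)^#` is evaluative over `X^#`. -/
def Evaluative (P : CStarPresentation C(X, ℂ)) (Q : SpacePresentation X) : Prop :=
  ∃ c : ℕ, IsEvaluationIndex P Q c

end Evaluation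

/-- The partial computable function `ψ` is an algorithm that, given any index `e` of a presentation
`C*(X)^#`, produces an index `a` of a presentation `X^#` and an index `b` of a total boundedness
function for `X^#` so that `C*(X)^#` is evaluative over `X^#`, uniformly in `e`: the algorithm
also produces an index `c` that witnesses the evaluativeness. -/
def IsEvaluativeSpaceAlgorithm (X : Type*) [TopologicalSpace X] [CompactSpace X]
    (ψ : ℕ →. ℕ × ℕ × ℕ) : Prop :=
  Partrec ψ ∧
  ∀ (e : ℕ) (P : CStarPresentation C(X, ℂ)), P.HasIndex e →
    ∃ a b c : ℕ, (a, b, c) ∈ ψ e ∧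
      ∃ Q : SpacePresentation X, Q.HasIndex a ∧
        (∃ f : ℕ → ℕ, IsIndexOf b f ∧ Q.IsTotalBoundednessFunction f) ∧
        IsEvaluationIndex P Q c

end EvalPres

/-! The space is `ℕ∞`, and the obstruction is that an index of a presentation cannot reveal whether
a given generator vanishes somewhere. To each machine `c` one attaches 0-1 rows: row `m + 1` is
`1⋯100⋯` with `m + 1` ones, and row `0` has a one at every stage by which `c` has halted on input
`0`. The vector `u_n` is the indicator function whose value at the point given by a row is the
`n`-th bit.

If `c` never halts, row `0` is zero and is not realized by a point. The `u_n` are then the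
indicators of the tails of `ℕ∞`, and `u_0 = 1` (`exists_realizes_of_not_dom`). If `c` halts, row `0`
gives one extra isolated point at which `u_0` vanishes, and the space is again homeomorphic to `ℕ∞`
(`exists_realizes_of_dom`). A polynomial without constant term vanishes on the zero row, so the
maximum of its modulus over finitely many rows is its norm in both cases. Hence one algorithm,
ignorant of whether `c` halts, enumerates the diagram (`Realizes.mem_diagram_iff`,
`exists_computable_index_family`).

Evaluation together with total boundedness would make "`u_0` has no zero" verifiable on these
presentations. A finite search finds a cover by balls on each of which a finite run of the
evaluation machine keeps `u_0` away from `0`. Such certificates are sound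
(`Certified.vec_apply_ne_zero`), and by compactness one exists when `u_0 = 1` (`exists_certified`).
The supposed algorithm would thus make non-halting recursively enumerable. -/

namespace EvalPres

open Nat.Partrec (Code)

/-! ### Arithmetic on codes of rational numbers -/

/-- Addition on codes of rational numbers. -/
def addCode (m n : ℕ) : ℕ :=
  Nat.pair
    (Nat.pair
      (m.unpair.1.unpair.1 * (n.unpair.2 + 1) + n.unpair.1.unpair.1 * (m.unpair.2 + 1))
      (m.unpair.1.unpair.2 * (n.unpair.2 + 1) + n.unpair.1.unpair.2 * (m.unpair.2 + 1)))
    (m.unpair.2 * n.unpair.2 + m.unpair.2 + n.unpair.2)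

/-- Multiplication on codes of rational numbers. -/
def mulCode (m n : ℕ) : ℕ :=
  Nat.pair
    (Nat.pair
      (m.unpair.1.unpair.1 * n.unpair.1.unpair.1 + m.unpair.1.unpair.2 * n.unpair.1.unpair.2)
      (m.unpair.1.unpair.1 * n.unpair.1.unpair.2 + m.unpair.1.unpair.2 * n.unpair.1.unpair.1))
    (m.unpair.2 * n.unpair.2 + m.unpair.2 + n.unpair.2)

/-- The strict order on codes of rational numbers. -/
def ltCode (m n : ℕ) : Prop :=
  m.unpair.1.unpair.1 * (n.unpair.2 + 1) + n.unpair.1.unpair.2 * (m.unpair.2 + 1) <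
    n.unpair.1.unpair.1 * (m.unpair.2 + 1) + m.unpair.1.unpair.2 * (n.unpair.2 + 1)

theorem ratOfNat_addCode (m n : ℕ) : ratOfNat (addCode m n) = ratOfNat m + ratOfNat n := by
  have h1 : ((m.unpair.2 : ℚ) + 1) ≠ 0 := by positivity
  have h2 : ((n.unpair.2 : ℚ) + 1) ≠ 0 := by positivity
  have h3 : ((m.unpair.2 : ℚ) * n.unpair.2 + m.unpair.2 + n.unpair.2 + 1) =
    (m.unpair.2 + 1) * (n.unpair.2 + 1) := by ring
  simp only [ratOfNat, addCode, Nat.unpair_pair, Nat.cast_add, Nat.cast_mul, Nat.cast_one, h3]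
  field_simp
  ring

theorem ratOfNat_mulCode (m n : ℕ) : ratOfNat (mulCode m n) = ratOfNat m * ratOfNat n := by
  have h1 : ((m.unpair.2 : ℚ) + 1) ≠ 0 := by positivity
  have h2 : ((n.unpair.2 : ℚ) + 1) ≠ 0 := by positivity
  have h3 : ((m.unpair.2 : ℚ) * n.unpair.2 + m.unpair.2 + n.unpair.2 + 1) =
    (m.unpair.2 + 1) * (n.unpair.2 + 1) := by ring
  simp only [ratOfNat, mulCode, Nat.unpair_pair, Nat.cast_add, Nat.cast_mul, h3]
  field_simp
  ring

/-- Cross-multiplying by the positive denominators and moving the subtracted terms across leaves an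
inequality between natural numbers. -/
theorem ltCode_iff (m n : ℕ) : ltCode m n ↔ ratOfNat m < ratOfNat n := by
  have h1 : (0 : ℚ) < (m.unpair.2 : ℚ) + 1 := by positivity
  have h2 : (0 : ℚ) < (n.unpair.2 : ℚ) + 1 := by positivity
  rw [ratOfNat, ratOfNat, div_lt_div_iff₀ h1 h2, ltCode, ← Nat.cast_lt (α := ℚ)]
  push_cast
  constructor <;> intro h <;> linarith

theorem ratOfNat_zero : ratOfNat 0 = 0 := by simp [ratOfNat]

theorem exists_ratOfNat_eq (q : ℚ) : ∃ n, ratOfNat n = q := by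
  refine ⟨Nat.pair (Nat.pair q.num.toNat (-q.num).toNat) (q.den - 1), ?_⟩
  have h1 : ((q.den - 1 : ℕ) : ℚ) + 1 = q.den := by
    rw [Nat.cast_sub q.den_pos]; simp
  have h2 : (q.num.toNat : ℤ) - ((-q.num).toNat : ℤ) = q.num := by omega
  have h3 : (q.num.toNat : ℚ) - ((-q.num).toNat : ℚ) = q.num := by exact_mod_cast h2
  simp only [ratOfNat, Nat.unpair_pair, h1, h3]
  exact Rat.num_div_den q

theorem primrec_unpair_fst : Primrec fun n : ℕ => n.unpair.1 := Primrec.fst.comp Primrec.unpair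

theorem primrec_unpair_snd : Primrec fun n : ℕ => n.unpair.2 := Primrec.snd.comp Primrec.unpair

/-! ### Primitive recursiveness of bounded quantifiers and of rational arithmetic -/

section Primrec

theorem primrecPred_exists_lt {α : Type*} [Primcodable α] {N : α → ℕ} {R : ℕ → α → Prop}
    (hN : Primrec N) (hR : PrimrecRel R) : PrimrecPred fun a => ∃ n < N a, R n a :=
  PrimrecPred.of_eq
    ((PrimrecRel.exists_mem_list hR).comp (Primrec.list_range.comp hN) Primrec.id) (by simp)

theorem primrecPred_forall_lt {α : Type*} [Primcodable α] {N : α → ℕ} {R : ℕ → α → Prop}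
    (hN : Primrec N) (hR : PrimrecRel R) : PrimrecPred fun a => ∀ n < N a, R n a :=
  PrimrecPred.of_eq
    ((PrimrecRel.forall_mem_list hR).comp (Primrec.list_range.comp hN) Primrec.id) (by simp)

variable {α : Type*} [Primcodable α] {f g : α → ℕ}

theorem primrec_addCode (hf : Primrec f) (hg : Primrec g) :
    Primrec fun a => addCode (f a) (g a) := by
  have f1 := primrec_unpair_fst.comp (primrec_unpair_fst.comp hf)
  have f2 := primrec_unpair_snd.comp (primrec_unpair_fst.comp hf)
  have f3 := primrec_unpair_snd.comp hf
  have g1 := primrec_unpair_fst.comp (primrec_unpair_fst.comp hg)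
  have g2 := primrec_unpair_snd.comp (primrec_unpair_fst.comp hg)
  have g3 := primrec_unpair_snd.comp hg
  have f3' := Primrec.succ.comp f3
  have g3' := Primrec.succ.comp g3
  exact Primrec₂.natPair.comp
    (Primrec₂.natPair.comp
      (Primrec.nat_add.comp (Primrec.nat_mul.comp f1 g3') (Primrec.nat_mul.comp g1 f3'))
      (Primrec.nat_add.comp (Primrec.nat_mul.comp f2 g3') (Primrec.nat_mul.comp g2 f3')))
    (Primrec.nat_add.comp (Primrec.nat_add.comp (Primrec.nat_mul.comp f3 g3) f3) g3)

theorem primrec_mulCode (hf : Primrec f) (hg : Primrec g) :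
    Primrec fun a => mulCode (f a) (g a) := by
  have f1 := primrec_unpair_fst.comp (primrec_unpair_fst.comp hf)
  have f2 := primrec_unpair_snd.comp (primrec_unpair_fst.comp hf)
  have f3 := primrec_unpair_snd.comp hf
  have g1 := primrec_unpair_fst.comp (primrec_unpair_fst.comp hg)
  have g2 := primrec_unpair_snd.comp (primrec_unpair_fst.comp hg)
  have g3 := primrec_unpair_snd.comp hg
  exact Primrec₂.natPair.comp
    (Primrec₂.natPair.comp
      (Primrec.nat_add.comp (Primrec.nat_mul.comp f1 g1) (Primrec.nat_mul.comp f2 g2))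
      (Primrec.nat_add.comp (Primrec.nat_mul.comp f1 g2) (Primrec.nat_mul.comp f2 g1)))
    (Primrec.nat_add.comp (Primrec.nat_add.comp (Primrec.nat_mul.comp f3 g3) f3) g3)

theorem primrecPred_ltCode (hf : Primrec f) (hg : Primrec g) :
    PrimrecPred fun a => ltCode (f a) (g a) := by
  have f1 := primrec_unpair_fst.comp (primrec_unpair_fst.comp hf)
  have f2 := primrec_unpair_snd.comp (primrec_unpair_fst.comp hf)
  have f3' := Primrec.succ.comp (primrec_unpair_snd.comp hf)
  have g1 := primrec_unpair_fst.comp (primrec_unpair_fst.comp hg)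
  have g2 := primrec_unpair_snd.comp (primrec_unpair_fst.comp hg)
  have g3' := Primrec.succ.comp (primrec_unpair_snd.comp hg)
  exact Primrec.nat_lt.comp
    (Primrec.nat_add.comp (Primrec.nat_mul.comp f1 g3') (Primrec.nat_mul.comp g2 f3'))
    (Primrec.nat_add.comp (Primrec.nat_mul.comp g1 f3') (Primrec.nat_mul.comp f2 g3'))

end Primrec

attribute [irreducible] addCode mulCode ltCode

set_option linter.overlappingInstances false in
theorem primrec_ofNat_of_encodable (α : Type*) [Primcodable α] [D : Denumerable α]
    (h : D.toEncodable = Primcodable.toEncodable) : Primrec (Denumerable.ofNat α) := by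
  refine Primrec.option_some_iff.1 (Primrec.decode.of_eq fun n => ?_)
  rw [← h]
  exact Denumerable.decode_eq_ofNat α n

theorem primrec_polyOfNat : Primrec polyOfNat := primrec_ofNat_of_encodable _ rfl

theorem primrec_ofNat_listNat : Primrec (Denumerable.ofNat (List ℕ)) :=
  primrec_ofNat_of_encodable _ rfl

/-! ### The rows of bits that approximate the characters -/

/-- The index of the indeterminate of a letter. -/
def letterIdx : Letter → ℕ := Sum.elim id id

/-- The bit at position `n` of row `m`. Row `m + 1` is `1 ⋯ 1 0 0 ⋯` with `m + 1` ones, and row `0`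
records the stages by which `c` has halted on input `0`. -/
def Bit (c : Code) (m n : ℕ) : Prop := n < m ∨ (m = 0 ∧ (Code.evaln n c 0).isSome)

/-- The monomials all of whose letters have bit one in row `m`. -/
def Alive (mono : ℕ × Letter × List Letter) (y : Code × ℕ) : Prop :=
  ∀ l ∈ mono.2.1 :: mono.2.2, Bit y.1 y.2 (letterIdx l)

open Classical in
/-- The part of `p` that survives in row `m`. -/
noncomputable def alivePart (p : RatStarPoly) (y : Code × ℕ) : RatStarPoly :=
  p.filter fun mono => Alive mono y

/-- A code of the sum of the real parts of the coefficients. -/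
def sumRe (p : RatStarPoly) : ℕ := p.foldr (fun mono a => addCode mono.1.unpair.1 a) 0

/-- A code of the sum of the imaginary parts of the coefficients. -/
def sumIm (p : RatStarPoly) : ℕ := p.foldr (fun mono a => addCode mono.1.unpair.2 a) 0

/-- A code of the squared modulus of the sum of the coefficients. -/
def sumNormSq (p : RatStarPoly) : ℕ :=
  addCode (mulCode (sumRe p) (sumRe p)) (mulCode (sumIm p) (sumIm p))

/-- The sum of the coefficients. -/
noncomputable def coeffSum (p : RatStarPoly) : ℂ := (p.map fun mono => cplxOfNat mono.1).sum

theorem coeffSum_eq (p : RatStarPoly) :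
    coeffSum p = ((ratOfNat (sumRe p) : ℝ) : ℂ) + ((ratOfNat (sumIm p) : ℝ) : ℂ) * Complex.I := by
  induction p with
  | nil => simp [coeffSum, sumRe, sumIm, ratOfNat_zero]
  | cons a p ih =>
    have h : coeffSum (a :: p) = cplxOfNat a.1 + coeffSum p := by simp [coeffSum]
    have hr : sumRe (a :: p) = addCode a.1.unpair.1 (sumRe p) := rfl
    have hi : sumIm (a :: p) = addCode a.1.unpair.2 (sumIm p) := rfl
    rw [h, ih, hr, hi, ratOfNat_addCode, ratOfNat_addCode, cplxOfNat]
    push_cast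
    ring

/-- Squared moduli stay rational, so norms can be compared with rationals without square roots. -/
theorem ratOfNat_sumNormSq (p : RatStarPoly) :
    ((ratOfNat (sumNormSq p) : ℚ) : ℝ) = ‖coeffSum p‖ ^ 2 := by
  rw [coeffSum_eq, ← Complex.normSq_eq_norm_sq, Complex.normSq_add_mul_I, sumNormSq,
    ratOfNat_addCode, ratOfNat_mulCode, ratOfNat_mulCode]
  push_cast
  ring

theorem primrec_letterIdx : Primrec letterIdx :=
  (Primrec.sumCasesOn Primrec.id (Primrec.snd.to₂ (α := Letter) (β := ℕ))
    (Primrec.snd.to₂ (α := Letter) (β := ℕ))).of_eq fun l => by cases l <;> rfl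

theorem primrecPred_bit {α : Type*} [Primcodable α] {c : α → Code} {m n : α → ℕ}
    (hc : Primrec c) (hm : Primrec m) (hn : Primrec n) :
    PrimrecPred fun a => Bit (c a) (m a) (n a) := by
  refine (Primrec.nat_lt.comp hn hm).or ((Primrec.eq.comp hm (Primrec.const 0)).and ?_)
  refine PrimrecPred.of_eq (p := fun a => (Code.evaln (n a) (c a) 0).isSome = true)
    (Primrec.eq.comp (Primrec.option_isSome.comp ?_) (Primrec.const true)) fun a => Iff.rfl
  exact Code.primrec_evaln.comp ((hn.pair hc).pair (Primrec.const 0))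

theorem primrecRel_alive : PrimrecRel Alive := by
  have h : PrimrecRel fun (l : Letter) (y : Code × ℕ) => Bit y.1 y.2 (letterIdx l) :=
    primrecPred_bit (Primrec.fst.comp Primrec.snd) (Primrec.snd.comp Primrec.snd)
      (primrec_letterIdx.comp Primrec.fst)
  have hm : Primrec fun a : (ℕ × Letter × List Letter) × (Code × ℕ) => a.1.2.1 :: a.1.2.2 :=
    Primrec.list_cons.comp (Primrec.fst.comp (Primrec.snd.comp Primrec.fst))
      (Primrec.snd.comp (Primrec.snd.comp Primrec.fst))
  exact h.forall_mem_list.comp hm Primrec.snd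

theorem primrec_alivePart : Primrec₂ alivePart := by
  classical
  exact (PrimrecRel.listFilter primrecRel_alive).of_eq fun a b => by
    unfold alivePart; congr

theorem primrec_sumRe : Primrec sumRe := by
  have h : Primrec₂ fun (_ : RatStarPoly) (b : (ℕ × Letter × List Letter) × ℕ) =>
      addCode b.1.1.unpair.1 b.2 :=
    primrec_addCode
      (primrec_unpair_fst.comp (Primrec.fst.comp (Primrec.fst.comp Primrec.snd)))
      (Primrec.snd.comp Primrec.snd)
  exact Primrec.list_foldr Primrec.id (Primrec.const 0) h

theorem primrec_sumIm : Primrec sumIm := by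
  have h : Primrec₂ fun (_ : RatStarPoly) (b : (ℕ × Letter × List Letter) × ℕ) =>
      addCode b.1.1.unpair.2 b.2 :=
    primrec_addCode
      (primrec_unpair_snd.comp (Primrec.fst.comp (Primrec.fst.comp Primrec.snd)))
      (Primrec.snd.comp Primrec.snd)
  exact Primrec.list_foldr Primrec.id (Primrec.const 0) h

theorem primrec_sumNormSq : Primrec sumNormSq :=
  primrec_addCode (primrec_mulCode primrec_sumRe primrec_sumRe)
    (primrec_mulCode primrec_sumIm primrec_sumIm)

/-! ### The diagram, decidable uniformly in the code -/

/-- A code of the squared modulus of the value of `𝔭_j` in row `m`. -/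
noncomputable def rowNormSq (c : Code) (j m : ℕ) : ℕ := sumNormSq (alivePart (polyOfNat j) (c, m))

/-- `n` codes an element of the diagram attached to `c`. -/
def InDiagram (c : Code) (n : ℕ) : Prop :=
  ltCode 0 n.unpair.1 ∧ ltCode 0 n.unpair.2.unpair.2 ∧
    (∃ m < n.unpair.2.unpair.1 + 2, ltCode (mulCode n.unpair.1 n.unpair.1)
      (rowNormSq c n.unpair.2.unpair.1 m)) ∧
    ∀ m < n.unpair.2.unpair.1 + 2, ltCode (rowNormSq c n.unpair.2.unpair.1 m)
      (mulCode n.unpair.2.unpair.2 n.unpair.2.unpair.2)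

theorem primrec_rowNormSq {α : Type*} [Primcodable α] {c : α → Code} {j m : α → ℕ}
    (hc : Primrec c) (hj : Primrec j) (hm : Primrec m) :
    Primrec fun a => rowNormSq (c a) (j a) (m a) :=
  primrec_sumNormSq.comp (primrec_alivePart.comp (primrec_polyOfNat.comp hj) (hc.pair hm))

/-- Only finitely many rows enter, and each bit is decided by a step-bounded run; the halting of `c`
is never asked for. -/
theorem primrecRel_inDiagram : PrimrecRel InDiagram := by
  have hr : Primrec fun a : Code × ℕ => a.2.unpair.1 := primrec_unpair_fst.comp Primrec.snd
  have hj : Primrec fun a : Code × ℕ => a.2.unpair.2.unpair.1 :=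
    primrec_unpair_fst.comp (primrec_unpair_snd.comp Primrec.snd)
  have hs : Primrec fun a : Code × ℕ => a.2.unpair.2.unpair.2 :=
    primrec_unpair_snd.comp (primrec_unpair_snd.comp Primrec.snd)
  have hN : Primrec fun a : Code × ℕ => a.2.unpair.2.unpair.1 + 2 :=
    Primrec.nat_add.comp hj (Primrec.const 2)
  have hv : Primrec fun b : ℕ × (Code × ℕ) => rowNormSq b.2.1 b.2.2.unpair.2.unpair.1 b.1 :=
    primrec_rowNormSq (Primrec.fst.comp Primrec.snd) (hj.comp Primrec.snd) Primrec.fst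
  have h1 : PrimrecRel fun (m : ℕ) (a : Code × ℕ) =>
      ltCode (mulCode a.2.unpair.1 a.2.unpair.1) (rowNormSq a.1 a.2.unpair.2.unpair.1 m) :=
    primrecPred_ltCode (primrec_mulCode (hr.comp Primrec.snd) (hr.comp Primrec.snd)) hv
  have h2 : PrimrecRel fun (m : ℕ) (a : Code × ℕ) =>
      ltCode (rowNormSq a.1 a.2.unpair.2.unpair.1 m)
        (mulCode a.2.unpair.2.unpair.2 a.2.unpair.2.unpair.2) :=
    primrecPred_ltCode hv (primrec_mulCode (hs.comp Primrec.snd) (hs.comp Primrec.snd))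
  have h3 := primrecPred_exists_lt hN h1
  have h4 := primrecPred_forall_lt hN h2
  exact (primrecPred_ltCode (Primrec.const 0) hr).and
    ((primrecPred_ltCode (Primrec.const 0) hs).and (h3.and h4))

open Classical in
/-- An enumeration of the diagram attached to `c`, given one of its elements `n₀`. -/
noncomputable def diagramEnum (n₀ : ℕ) (c : Code) (n : ℕ) : ℕ := if InDiagram c n then n else n₀

theorem primrec_diagramEnum (n₀ : ℕ) : Primrec₂ (diagramEnum n₀) := by
  classical
  exact (Primrec.ite primrecRel_inDiagram Primrec.snd (Primrec.const n₀)).of_eq fun a => by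
    simp only [diagramEnum]

/-- Uniformly computable functions have computable indices. -/
theorem exists_computable_index {F : Code → ℕ → ℕ} (hF : Computable₂ F) :
    ∃ e : Code → ℕ, Computable e ∧ ∀ c, IsIndexOf (e c) (F c) := by
  have h : Computable fun n : ℕ => F (Denumerable.ofNat Code n.unpair.1) n.unpair.2 :=
    hF.comp ((Computable.ofNat Code).comp primrec_unpair_fst.to_comp) primrec_unpair_snd.to_comp
  obtain ⟨d, hd⟩ := Code.exists_code.1 (Partrec.nat_iff.1 h.partrec)
  -- The s-m-n theorem: `c` is hard-wired as the first argument of a single code `d`.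
  refine ⟨fun c => Encodable.encode (Code.curry d (Encodable.encode c)), ?_, fun c n => ?_⟩
  · exact Computable.encode.comp
      (Code.primrec₂_curry.to_comp.comp (Computable.const d) Computable.encode)
  · rw [phi, Denumerable.ofNat_encode, Code.eval_curry, hd]
    simp

/-! ### Presentations by indicator functions of clopen sets -/

section Indicator

variable {X : Type*} [TopologicalSpace X]

/-- The indicator function of a clopen set. -/
noncomputable def clopenInd {U : Set X} (hU : IsClopen U) : C(X, ℂ) :=
  (LocallyConstant.charFn ℂ hU : LocallyConstant X ℂ)

theorem clopenInd_apply_of_mem {U : Set X} (hU : IsClopen U) {x : X} (hx : x ∈ U) :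
    clopenInd hU x = 1 := (LocallyConstant.charFn_eq_one ℂ x hU).2 hx

theorem clopenInd_apply_of_notMem {U : Set X} (hU : IsClopen U) {x : X} (hx : x ∉ U) :
    clopenInd hU x = 0 := (LocallyConstant.charFn_eq_zero ℂ x hU).2 hx

variable [CompactSpace X]

/-- Stone–Weierstrass: once the unit lies in the non-unital algebra, that algebra is a unital star
subalgebra, and the clopen sets separate points. -/
theorem dense_adjoin_range_clopenInd {U : ℕ → Set X} (hU : ∀ n, IsClopen (U n))
    (hsep : ∀ x y, x ≠ y → ∃ n, ¬ (x ∈ U n ↔ y ∈ U n))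
    (hone : (1 : C(X, ℂ)) ∈
      NonUnitalStarAlgebra.adjoin ℂ (Set.range fun n => clopenInd (hU n))) :
    Dense (NonUnitalStarAlgebra.adjoin ℂ (Set.range fun n => clopenInd (hU n)) :
      Set C(X, ℂ)) := by
  set S := NonUnitalStarAlgebra.adjoin ℂ (Set.range fun n => clopenInd (hU n)) with hS
  have h : (S.toStarSubalgebra hone).topologicalClosure = ⊤ := by
    refine ContinuousMap.starSubalgebra_topologicalClosure_eq_top_of_separatesPoints _ ?_
    intro x y hxy
    obtain ⟨n, hn⟩ := hsep x y hxy
    refine ⟨_, ⟨clopenInd (hU n), NonUnitalStarAlgebra.subset_adjoin ℂ _ ⟨n, rfl⟩, rfl⟩, ?_⟩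
    by_cases hx : x ∈ U n
    · have hy : y ∉ U n := fun hy => hn ⟨fun _ => hy, fun _ => hx⟩
      simp [clopenInd_apply_of_mem (hU n) hx, clopenInd_apply_of_notMem (hU n) hy]
    · have hy : y ∈ U n := by
        by_contra hy
        exact hn ⟨fun h => (hx h).elim, fun h => (hy h).elim⟩
      simp [clopenInd_apply_of_notMem (hU n) hx, clopenInd_apply_of_mem (hU n) hy]
  have h2 : closure (S : Set C(X, ℂ)) = Set.univ :=
    congrArg (fun T : StarSubalgebra ℂ C(X, ℂ) => (T : Set C(X, ℂ))) h
  exact dense_iff_closure_eq.2 h2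

theorem letterEval_clopenInd_apply {U : ℕ → Set X} (hU : ∀ n, IsClopen (U n)) (l : Letter)
    (x : X) : letterEval (fun n => clopenInd (hU n)) l x = clopenInd (hU (letterIdx l)) x := by
  cases l with
  | inl j => rfl
  | inr j =>
    change star (clopenInd (hU j) x) = clopenInd (hU j) x
    by_cases hx : x ∈ U j
    · simp [clopenInd_apply_of_mem (hU j) hx]
    · simp [clopenInd_apply_of_notMem (hU j) hx]

open Classical in
theorem wordEval_clopenInd_apply {U : ℕ → Set X} (hU : ∀ n, IsClopen (U n)) (l : Letter)
    (w : List Letter) (x : X) :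
    wordEval (fun n => clopenInd (hU n)) l w x =
      if ∀ k ∈ l :: w, x ∈ U (letterIdx k) then 1 else 0 := by
  induction w using List.reverseRecOn with
  | nil =>
    simp only [wordEval, List.map_nil, List.foldl_nil, letterEval_clopenInd_apply]
    by_cases hx : x ∈ U (letterIdx l)
    · simp [clopenInd_apply_of_mem _ hx, hx]
    · simp [clopenInd_apply_of_notMem _ hx, hx]
  | append_singleton w k ih =>
    have h : wordEval (fun n => clopenInd (hU n)) l (w ++ [k]) =
        wordEval (fun n => clopenInd (hU n)) l w * letterEval (fun n => clopenInd (hU n)) k := by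
      simp [wordEval]
    rw [h, ContinuousMap.mul_apply, ih, letterEval_clopenInd_apply]
    by_cases hx : x ∈ U (letterIdx k)
    · rw [clopenInd_apply_of_mem _ hx, mul_one]
      congr 1
      simp only [eq_iff_iff, List.mem_cons, List.mem_append, List.not_mem_nil, or_false]
      constructor
      · rintro h j (hj | hj | hj)
        · exact h j (Or.inl hj)
        · exact h j (Or.inr hj)
        · exact hj ▸ hx
      · rintro h j (hj | hj)
        · exact h j (Or.inl hj)
        · exact h j (Or.inr (Or.inl hj))
    · rw [clopenInd_apply_of_notMem _ hx, mul_zero, if_neg]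
      intro h
      exact hx (h k (by simp))

/-- At a point a word of indicators is `1` or `0` according to whether all its letters have bit one,
so only the coefficients of the alive monomials are summed. Agreement with the row is needed only at
the indeterminates that occur. -/
theorem polyEval_clopenInd_apply {U : ℕ → Set X} (hU : ∀ n, IsClopen (U n)) {c : Code} {m : ℕ}
    {x : X} (p : RatStarPoly)
    (h : ∀ mono ∈ p, ∀ l ∈ mono.2.1 :: mono.2.2,
      (x ∈ U (letterIdx l) ↔ Bit c m (letterIdx l))) :
    polyEval (fun n => clopenInd (hU n)) p x = coeffSum (alivePart p (c, m)) := by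
  classical
  induction p with
  | nil => simp [polyEval, coeffSum, alivePart]
  | cons a p ih =>
    have h1 : polyEval (fun n => clopenInd (hU n)) (a :: p) =
        cplxOfNat a.1 • wordEval (fun n => clopenInd (hU n)) a.2.1 a.2.2 +
          polyEval (fun n => clopenInd (hU n)) p := by simp [polyEval]
    have h2 : (∀ k ∈ a.2.1 :: a.2.2, x ∈ U (letterIdx k)) ↔ Alive a (c, m) :=
      forall₂_congr fun l hl => h a List.mem_cons_self l hl
    rw [h1, ContinuousMap.add_apply, ContinuousMap.smul_apply,
      ih fun mono hm => h mono (List.mem_cons_of_mem _ hm), wordEval_clopenInd_apply]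
    by_cases ha : Alive a (c, m)
    · rw [if_pos (h2.2 ha)]
      simp [alivePart, coeffSum, ha]
    · rw [if_neg (mt h2.1 ha)]
      simp [alivePart, coeffSum, ha]

end Indicator

/-! ### Bounds on the indeterminates of coded polynomials -/

theorem encode_le_encode_of_mem {α : Type*} [Encodable α] {a : α} {l : List α} (h : a ∈ l) :
    Encodable.encode a ≤ Encodable.encode l := by
  induction l with
  | nil => simp at h
  | cons b l ih =>
    rw [Encodable.encode_list_cons]
    rcases List.mem_cons.1 h with rfl | h
    · exact (Nat.left_le_pair _ _).trans (Nat.le_succ _)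
    · exact (ih h).trans ((Nat.right_le_pair _ _).trans (Nat.le_succ _))

theorem letterIdx_le_encode (l : Letter) : letterIdx l ≤ Encodable.encode l := by
  cases l with
  | inl j =>
    have : Encodable.encode (Sum.inl j : Letter) = 2 * j := by simp
    rw [this]; change j ≤ _; omega
  | inr j =>
    have : Encodable.encode (Sum.inr j : Letter) = 2 * j + 1 := by simp
    rw [this]; change j ≤ _; omega

/-- Pairing dominates its components, so the code of a polynomial bounds everything inside it. This
is why `j + 2` rows suffice for `𝔭_j`. -/
theorem letterIdx_le_of_mem_polyOfNat {j : ℕ} {mono : ℕ × Letter × List Letter}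
    (hm : mono ∈ polyOfNat j) {l : Letter} (hl : l ∈ mono.2.1 :: mono.2.2) : letterIdx l ≤ j := by
  have h1 : Encodable.encode mono ≤ j := by
    have := encode_le_encode_of_mem hm
    rwa [polyOfNat, Denumerable.encode_ofNat] at this
  have h2 : Encodable.encode mono.2 ≤ Encodable.encode mono := by
    exact Nat.right_le_pair _ _
  have h3 : Encodable.encode l ≤ Encodable.encode mono.2 := by
    rcases List.mem_cons.1 hl with rfl | hl
    · exact Nat.left_le_pair _ _
    · exact (encode_le_encode_of_mem hl).trans (Nat.right_le_pair _ _)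
  exact (letterIdx_le_encode l).trans (h3.trans (h2.trans h1))

/-! ### Names of presentations by indicator functions -/

theorem exists_tripleOfNat_eq (t : ℚ × ℕ × ℚ) : ∃ n, tripleOfNat n = t := by
  obtain ⟨r, j, s⟩ := t
  obtain ⟨a, ha⟩ := exists_ratOfNat_eq r
  obtain ⟨b, hb⟩ := exists_ratOfNat_eq s
  exact ⟨Nat.pair a (Nat.pair j b), by simp [tripleOfNat, ha, hb]⟩

/-- The presentation `P` consists of indicator functions of clopen sets whose membership patterns
are, up to the zero pattern, the limits of the rows of `c`. -/
structure Realizes {X : Type*} [TopologicalSpace X] [CompactSpace X]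
    (P : CStarPresentation C(X, ℂ)) (c : Code) (U : ℕ → Set X) : Prop where
  isClopen : ∀ n, IsClopen (U n)
  vec_eq : P.vec = fun n => clopenInd (isClopen n)
  exists_row : ∀ x N, ∃ m < N + 2, ∀ n ≤ N, (x ∈ U n ↔ Bit c m n)
  row : ∀ m, (∃ x, ∀ n, (x ∈ U n ↔ Bit c m n)) ∨ ∀ n, ¬ Bit c m n

namespace Realizes

variable {X : Type*} [TopologicalSpace X] [CompactSpace X] {P : CStarPresentation C(X, ℂ)}
  {c : Code} {U : ℕ → Set X}

theorem rowNormSq_eq (c : Code) (j m : ℕ) :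
    ((ratOfNat (rowNormSq c j m) : ℚ) : ℝ) = ‖coeffSum (alivePart (polyOfNat j) (c, m))‖ ^ 2 :=
  ratOfNat_sumNormSq _

theorem ratVec_apply (h : Realizes P c U) {j m : ℕ} {x : X}
    (hx : ∀ n ≤ j, (x ∈ U n ↔ Bit c m n)) :
    P.ratVec j x = coeffSum (alivePart (polyOfNat j) (c, m)) := by
  rw [CStarPresentation.ratVec, h.vec_eq]
  exact polyEval_clopenInd_apply h.isClopen _ fun mono hm l hl =>
    hx _ (letterIdx_le_of_mem_polyOfNat hm hl)

theorem norm_coeffSum_le (h : Realizes P c U) (j m : ℕ) :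
    ‖coeffSum (alivePart (polyOfNat j) (c, m))‖ ≤ ‖P.ratVec j‖ := by
  classical
  rcases h.row m with ⟨x, hx⟩ | hm
  · rw [← h.ratVec_apply fun n _ => hx n]
    exact ContinuousMap.norm_coe_le_norm _ x
  -- A zero row kills every monomial, since words are nonempty; the absence of constant terms is
  -- essential here.
  · have : alivePart (polyOfNat j) (c, m) = [] := by
      refine List.filter_eq_nil_iff.2 fun mono _ ha => ?_
      exact hm _ ((decide_eq_true_iff.1 ha) mono.2.1 List.mem_cons_self)
    rw [this]
    simp [coeffSum]

/-- By compactness the norm is attained at a point, which up to position `j` looks like one of the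
first `j + 2` rows. -/
theorem exists_norm_eq [Nonempty X] (h : Realizes P c U) (j : ℕ) :
    ∃ m < j + 2, ‖P.ratVec j‖ = ‖coeffSum (alivePart (polyOfNat j) (c, m))‖ := by
  obtain ⟨x, -, hx⟩ := isCompact_univ.exists_isMaxOn Set.univ_nonempty
    (P.ratVec j).continuous.norm.continuousOn
  obtain ⟨m, hm, hmx⟩ := h.exists_row x j
  refine ⟨m, hm, le_antisymm ?_ (h.norm_coeffSum_le j m)⟩
  rw [← h.ratVec_apply hmx]
  exact (ContinuousMap.norm_le_of_nonempty _).2 fun y => hx (Set.mem_univ y)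

/-- The right-hand side mentions only `c`, so every presentation realizing `c` has the same diagram.
Comparing squares is legitimate because both rational bounds are positive. -/
theorem mem_diagram_iff [Nonempty X] (h : Realizes P c U) (n : ℕ) :
    tripleOfNat n ∈ P.diagram ↔ InDiagram c n := by
  obtain ⟨m₀, hm₀, hnorm⟩ := h.exists_norm_eq n.unpair.2.unpair.1
  have hle := h.norm_coeffSum_le n.unpair.2.unpair.1
  simp only [CStarPresentation.diagram, Set.mem_ofPred_eq, tripleOfNat, InDiagram, ltCode_iff,
    ratOfNat_mulCode, ratOfNat_zero]
  refine and_congr_right fun hr => and_congr_right fun hs => and_congr ?_ ?_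
  · have hr' : (0 : ℝ) < (ratOfNat n.unpair.1 : ℝ) := by exact_mod_cast hr
    constructor
    · intro hlt
      refine ⟨m₀, hm₀, ?_⟩
      rw [← Rat.cast_lt (K := ℝ), rowNormSq_eq, ← hnorm, Rat.cast_mul, ← sq]
      exact pow_lt_pow_left₀ hlt hr'.le two_ne_zero
    · rintro ⟨m, -, hlt⟩
      rw [← Rat.cast_lt (K := ℝ), rowNormSq_eq, Rat.cast_mul, ← sq] at hlt
      exact (lt_of_pow_lt_pow_left₀ 2 (norm_nonneg _) hlt).trans_le (hle m)
  · have hs' : (0 : ℝ) < (ratOfNat n.unpair.2.unpair.2 : ℝ) := by exact_mod_cast hs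
    constructor
    · intro hlt m _
      rw [← Rat.cast_lt (K := ℝ), rowNormSq_eq, Rat.cast_mul, ← sq]
      exact pow_lt_pow_left₀ ((hle m).trans_lt hlt) (norm_nonneg _) two_ne_zero
    · intro hlt
      have := hlt m₀ hm₀
      rw [← Rat.cast_lt (K := ℝ), rowNormSq_eq, Rat.cast_mul, ← sq, ← hnorm] at this
      exact lt_of_pow_lt_pow_left₀ 2 hs'.le this

theorem isName_diagramEnum [Nonempty X] (h : Realizes P c U) {n₀ : ℕ}
    (hn₀ : tripleOfNat n₀ ∈ P.diagram) : P.IsName (diagramEnum n₀ c) := by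
  classical
  ext t
  constructor
  · intro ht
    obtain ⟨n, rfl⟩ := exists_tripleOfNat_eq t
    exact ⟨n, by simp only [diagramEnum, if_pos ((h.mem_diagram_iff n).1 ht)]⟩
  · rintro ⟨n, rfl⟩
    by_cases hn : InDiagram c n
    · simp only [diagramEnum, if_pos hn]
      exact (h.mem_diagram_iff n).2 hn
    · simpa only [diagramEnum, if_neg hn] using hn₀

end Realizes

/-! ### The first distinguished vector -/

/-- The polynomial `x_0` has one number that serves every presentation. -/
theorem exists_ratVec_eq_vec_zero : ∃ j : ℕ, ∀ {A : Type} [NonUnitalCStarAlgebra A]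
    (P : CStarPresentation A), P.ratVec j = P.vec 0 := by
  obtain ⟨a, ha⟩ := exists_ratOfNat_eq 1
  refine ⟨Encodable.encode ([(Nat.pair a 0, Sum.inl 0, [])] : RatStarPoly), fun P => ?_⟩
  have h : cplxOfNat (Nat.pair a 0) = 1 := by simp [cplxOfNat, ha, ratOfNat_zero]
  rw [CStarPresentation.ratVec, polyOfNat, Denumerable.ofNat_encode]
  simp [polyEval, h, wordEval, letterEval]

/-! ### The two presentations of the continuous functions on `ℕ∞` -/

/-- A copy of the sequence of tails of `ℕ∞`, with the point `0` joining at the stage at which `c`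
has halted. -/
def joinedTail (c : Code) (n : ℕ) : Set ℕ∞ :=
  {x | (n : ℕ∞) + 1 ≤ x ∨ (x = 0 ∧ (Code.evaln n c 0).isSome)}

theorem isClopen_Ici_natCast (n : ℕ) : IsClopen (Set.Ici (n : ℕ∞)) := by
  refine ⟨isClosed_Ici, ?_⟩
  cases n with
  | zero => simp
  | succ n =>
    have : Set.Ici ((n + 1 : ℕ) : ℕ∞) = Set.Ioi (n : ℕ∞) := by
      ext x
      simp only [Set.mem_Ici, Set.mem_Ioi, Nat.cast_add, Nat.cast_one]
      exact ENat.add_one_le_iff (ENat.natCast_ne_top n)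
    rw [this]
    exact isOpen_Ioi

theorem isClopen_joinedTail (c : Code) (n : ℕ) : IsClopen (joinedTail c n) := by
  have h1 : IsClopen ({0} : Set ℕ∞) := by
    have : ({0} : Set ℕ∞) = (Set.Ici ((1 : ℕ) : ℕ∞))ᶜ := by
      ext x
      simp
    rw [this]
    exact (isClopen_Ici_natCast 1).compl
  have h2 := isClopen_Ici_natCast (n + 1)
  by_cases hn : (Code.evaln n c 0).isSome
  · convert h2.union h1 using 1
    ext x
    simp [joinedTail, hn, or_comm]
  · convert h2 using 1
    ext x
    simp [joinedTail, hn]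

theorem bit_zero (c : Code) (n : ℕ) : Bit c 0 n ↔ (Code.evaln n c 0).isSome := by
  simp [Bit]

theorem bit_succ (c : Code) (m n : ℕ) : Bit c (m + 1) n ↔ n ≤ m := by
  simp [Bit]

theorem not_isSome_evaln_zero (c : Code) : ¬ (Code.evaln 0 c 0).isSome := by
  simp [Code.evaln]

theorem dom_of_isSome_evaln {c : Code} {n : ℕ} (h : (Code.evaln n c 0).isSome) :
    (c.eval 0).Dom := by
  obtain ⟨v, hv⟩ := Option.isSome_iff_exists.1 h
  exact Part.dom_iff_mem.2 ⟨v, Code.evaln_sound hv⟩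

/-- If `c` does not halt, its rows are realized by a presentation whose first vector is the
unit. -/
theorem exists_realizes_of_not_dom {c : Code} (hc : ¬ (c.eval 0).Dom) :
    ∃ (P : CStarPresentation C(ℕ∞, ℂ)) (U : ℕ → Set ℕ∞),
      Realizes P c U ∧ ∀ x, P.vec 0 x = 1 := by
  have hU := isClopen_Ici_natCast
  have h1 : ∀ x, clopenInd (hU 0) x = 1 := fun x => clopenInd_apply_of_mem _ (by simp)
  have h0 : clopenInd (hU 0) = 1 := ContinuousMap.ext h1
  refine ⟨⟨fun n => clopenInd (hU n), dense_adjoin_range_clopenInd hU ?_ ?_⟩, _,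
    ⟨hU, rfl, ?_, ?_⟩, h1⟩
  · intro x y hxy
    by_contra! h
    exact hxy (le_antisymm (ENat.forall_natCast_le_iff_le.1 fun n hn => (h n).1 hn)
      (ENat.forall_natCast_le_iff_le.1 fun n hn => (h n).2 hn))
  · exact NonUnitalStarAlgebra.subset_adjoin ℂ _ ⟨0, h0⟩
  · intro x N
    cases x using ENat.recTopCoe with
    | top => exact ⟨N + 1, by omega, fun n hn => by simp [bit_succ, hn]⟩
    -- Up to position `N`, the point `a` cannot be told from `min a N`, whose row has `min a N + 1`
    -- ones.
    | coe a =>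
      refine ⟨min a N + 1, by omega, fun n hn => ?_⟩
      simp [bit_succ, hn]
  · intro m
    cases m with
    | zero => exact Or.inr fun n hn => hc (dom_of_isSome_evaln ((bit_zero c n).1 hn))
    | succ m => exact Or.inl ⟨m, fun n => by simp [bit_succ]⟩

/-- If `c` halts, its rows are realized by a presentation whose first vector has a zero. -/
theorem exists_realizes_of_dom {c : Code} (hc : (c.eval 0).Dom) :
    ∃ (P : CStarPresentation C(ℕ∞, ℂ)) (U : ℕ → Set ℕ∞),
      Realizes P c U ∧ P.vec 0 0 = 0 ∧ P.vec 0 1 = 1 := by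
  have hU := isClopen_joinedTail c
  obtain ⟨v, hv⟩ := Part.dom_iff_mem.1 hc
  obtain ⟨s, hs⟩ := Code.evaln_complete.1 hv
  have hs' : (Code.evaln s c 0).isSome := Option.isSome_iff_exists.2 ⟨v, hs⟩
  have hmem0 : ∀ n, (0 : ℕ∞) ∈ joinedTail c n ↔ (Code.evaln n c 0).isSome := fun n => by
    simp [joinedTail]
  have hmem : ∀ (x : ℕ∞) n, x + 1 ∈ joinedTail c n ↔ (n : ℕ∞) ≤ x := fun x n => by
    simp [joinedTail]
  have hsucc : ∀ x : ℕ∞, x ≠ 0 → ∃ y, x = y + 1 := fun x hx =>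
    ⟨x - 1, (tsub_add_cancel_of_le (Order.one_le_iff_ne_zero.2 hx)).symm⟩
  refine ⟨⟨fun n => clopenInd (hU n), dense_adjoin_range_clopenInd hU ?_ ?_⟩, _,
    ⟨hU, rfl, ?_, ?_⟩, ?_, ?_⟩
  -- No machine halts within `0` steps, so position `0` separates the extra point from all others.
  · have hzero : ∀ y : ℕ∞, ¬ ((0 : ℕ∞) ∈ joinedTail c 0 ↔ y + 1 ∈ joinedTail c 0) := fun y => by
      rw [hmem0, hmem]
      simp [not_isSome_evaln_zero]
    intro x y hxy
    rcases eq_or_ne x 0 with rfl | hx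
    · obtain ⟨y, rfl⟩ := hsucc y hxy.symm
      exact ⟨0, hzero y⟩
    rcases eq_or_ne y 0 with rfl | hy
    · obtain ⟨x, rfl⟩ := hsucc x hx
      exact ⟨0, fun h => hzero x h.symm⟩
    obtain ⟨x, rfl⟩ := hsucc x hx
    obtain ⟨y, rfl⟩ := hsucc y hy
    by_contra! h
    simp only [hmem] at h
    exact hxy (congrArg (· + 1) (le_antisymm
      (ENat.forall_natCast_le_iff_le.1 fun n hn => (h n).1 hn)
      (ENat.forall_natCast_le_iff_le.1 fun n hn => (h n).2 hn)))
  -- `u_0` misses only the point `0`, and `u_s` covers it once `c` has halted by stage `s`;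
  -- inclusion–exclusion gives the unit.
  · have h1 : (1 : C(ℕ∞, ℂ)) = clopenInd (hU 0) + clopenInd (hU s) -
        clopenInd (hU 0) * clopenInd (hU s) := by
      ext x
      simp only [ContinuousMap.sub_apply, ContinuousMap.add_apply, ContinuousMap.mul_apply,
        ContinuousMap.one_apply]
      rcases eq_or_ne x 0 with rfl | hx
      · rw [clopenInd_apply_of_mem (hU s) ((hmem0 s).2 hs')]
        ring
      · obtain ⟨x, rfl⟩ := hsucc x hx
        rw [clopenInd_apply_of_mem (hU 0) ((hmem x 0).2 (by simp))]
        ring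
    have hin : ∀ n, clopenInd (hU n) ∈
        NonUnitalStarAlgebra.adjoin ℂ (Set.range fun n => clopenInd (hU n)) := fun n =>
      NonUnitalStarAlgebra.subset_adjoin ℂ _ ⟨n, rfl⟩
    rw [h1]
    exact sub_mem (add_mem (hin 0) (hin s)) (mul_mem (hin 0) (hin s))
  · intro x N
    rcases eq_or_ne x 0 with rfl | hx
    · exact ⟨0, by omega, fun n _ => by rw [hmem0, bit_zero]⟩
    obtain ⟨x, rfl⟩ := hsucc x hx
    cases x using ENat.recTopCoe with
    | top => exact ⟨N + 1, by omega, fun n hn => by rw [hmem, bit_succ]; simp [hn]⟩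
    | coe a =>
      refine ⟨min a N + 1, by omega, fun n hn => ?_⟩
      rw [hmem, bit_succ]
      simp [hn]
  · intro m
    cases m with
    | zero => exact Or.inl ⟨0, fun n => by rw [hmem0, bit_zero]⟩
    | succ m => exact Or.inl ⟨m + 1, fun n => by rw [hmem, bit_succ]; simp⟩
  · exact clopenInd_apply_of_notMem _ (by rw [hmem0]; exact not_isSome_evaln_zero c)
  · exact clopenInd_apply_of_mem _ (by simpa using (hmem 0 0).2 (by simp))

/-- There is a computable family of indices of presentations of `C*(ℕ∞)` such that the first
vector is the unit if the machine does not halt and has a zero if it does. -/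
theorem exists_computable_index_family :
    ∃ e : Code → ℕ, Computable e ∧
      (∀ c, ¬ (c.eval 0).Dom → ∃ P : CStarPresentation C(ℕ∞, ℂ), P.HasIndex (e c) ∧
        ∀ x, P.vec 0 x = 1) ∧
      ∀ c, (c.eval 0).Dom → ∃ P : CStarPresentation C(ℕ∞, ℂ), P.HasIndex (e c) ∧
        P.vec 0 0 = 0 := by
  obtain ⟨j, hj⟩ := exists_ratVec_eq_vec_zero
  -- The default element of the enumeration must lie in the diagram whether or not `c` halts. In
  -- both cases `u_0` is a nonzero projection, of norm `1`.
  obtain ⟨n₀, hn₀⟩ := exists_tripleOfNat_eq (1 / 2, j, 2)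
  obtain ⟨e, he, hidx⟩ := exists_computable_index (primrec_diagramEnum n₀).to_comp
  have key : ∀ {c : Code} {P : CStarPresentation C(ℕ∞, ℂ)} {U : ℕ → Set ℕ∞},
      Realizes P c U → P.vec 0 1 = 1 → P.HasIndex (e c) := by
    intro c P U h h1
    have h01 : ∀ x, P.vec 0 x = 0 ∨ P.vec 0 x = 1 := by
      intro x
      rw [h.vec_eq]
      by_cases hx : x ∈ U 0
      · exact Or.inr (clopenInd_apply_of_mem _ hx)
      · exact Or.inl (clopenInd_apply_of_notMem _ hx)
    have hnorm : ‖P.vec 0‖ = 1 := by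
      refine le_antisymm ((ContinuousMap.norm_le_of_nonempty _).2 fun x => ?_) ?_
      · rcases h01 x with h | h <;> simp [h]
      · simpa [h1] using (P.vec 0).norm_coe_le_norm 1
    refine ⟨_, hidx c, h.isName_diagramEnum ?_⟩
    rw [hn₀]
    simp only [CStarPresentation.diagram, Set.mem_ofPred_eq, hj, hnorm]
    norm_num
  refine ⟨e, he, fun c hc => ?_, fun c hc => ?_⟩
  · obtain ⟨P, U, h, h1⟩ := exists_realizes_of_not_dom hc
    exact ⟨P, key h (h1 1), h1⟩
  · obtain ⟨P, U, h, h0, h1⟩ := exists_realizes_of_dom hc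
    exact ⟨P, key h h1, h0⟩

/-! ### Certificates that the first vector has no zero -/

/-- The result of `t` steps of the machine with index `a`. -/
def runFor (t a n : ℕ) : Option ℕ := Code.evaln t (Denumerable.ofNat Code a) n

/-- A code of the rational number `2^{-(i+1)}`. -/
def halfPowCode (i : ℕ) : ℕ := Nat.pair (Nat.pair 1 0) (2 ^ (i + 1) - 1)

/-- Within `t` steps, the name with index `a` shows that the special points `n` and `k` are closer
than `2^{-(i+1)}`. -/
def ShownClose (t a n k i : ℕ) : Prop :=
  ∃ u < t, ∃ q < t, runFor t a u = some q ∧ q.unpair.2.unpair.1 = n ∧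
    q.unpair.2.unpair.2.unpair.1 = k ∧ ¬ ltCode (halfPowCode i) q.unpair.2.unpair.2.unpair.2

/-- Within `t` steps, the machine with index `c` evaluates the vector `j`, at the points that have a
name with the initial segment coded by `s`, to an approximation with real part above `1/2`. -/
def ShownLarge (j t c s : ℕ) : Prop :=
  ∃ w < t, runFor t c (Nat.pair 1 (Encodable.encode
    ((Denumerable.ofNat (List ℕ) s).map (Nat.pair j)))) = some w ∧
      ltCode (halfPowCode 0) w.unpair.1

/-- The code `s` of a list shows that the vector `j` does not vanish on the ball of radius
`2^{-l}` around the special point `k`. -/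
def LargeNear (j t a c l k s : ℕ) : Prop :=
  (Denumerable.ofNat (List ℕ) s).length ≤ l ∧ ShownLarge j t c s ∧
    ∀ i < (Denumerable.ofNat (List ℕ) s).length,
      ShownClose t a ((Denumerable.ofNat (List ℕ) s).getD i 0) k i

/-- Within `t` steps, the machines with the indices `y` show that the vector `j` has no zero. -/
def Certified (j : ℕ) (y : ℕ × ℕ × ℕ) (t : ℕ) : Prop :=
  ∃ l < t, ∃ v < t, runFor t y.2.1 l = some v ∧
    ∀ k ∈ Denumerable.ofNat (List ℕ) v, ∃ s < t, LargeNear j t y.1 y.2.2 l k s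

/-! ### Decidability of certificates -/

section Primrec

variable {α : Type*} [Primcodable α]

theorem primrec_runFor {t a n : α → ℕ} (ht : Primrec t) (ha : Primrec a) (hn : Primrec n) :
    Primrec fun x => runFor (t x) (a x) (n x) :=
  Code.primrec_evaln.comp ((ht.pair ((Primrec.ofNat Code).comp ha)).pair hn)

theorem primrec_two_pow : Primrec fun i : ℕ => 2 ^ i :=
  (Primrec.nat_rec₁ 1 (Primrec.nat_mul.comp (Primrec.snd (α := ℕ) (β := ℕ))
    (Primrec.const 2)).to₂).of_eq fun i => by
    induction i with
    | zero => rfl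
    | succ i ih => simp only [pow_succ, ← ih]

theorem primrec_halfPowCode : Primrec halfPowCode :=
  Primrec₂.natPair.comp (Primrec.const (Nat.pair 1 0))
    (Primrec.nat_sub.comp (primrec_two_pow.comp Primrec.succ) (Primrec.const 1))

theorem primrecPred_shownClose {t a n k i : α → ℕ} (ht : Primrec t) (ha : Primrec a)
    (hn : Primrec n) (hk : Primrec k) (hi : Primrec i) :
    PrimrecPred fun x => ShownClose (t x) (a x) (n x) (k x) (i x) := by
  have p : Primrec fun z : ℕ × ℕ × α => z.2.2 := Primrec.snd.comp Primrec.snd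
  have u : Primrec fun z : ℕ × ℕ × α => z.2.1 := Primrec.fst.comp Primrec.snd
  have q : Primrec fun z : ℕ × ℕ × α => z.1 := Primrec.fst
  have q2 := primrec_unpair_snd.comp q
  have q22 := primrec_unpair_snd.comp q2
  have h1 : PrimrecRel fun (q : ℕ) (z : ℕ × α) =>
      runFor (t z.2) (a z.2) z.1 = some q ∧ q.unpair.2.unpair.1 = n z.2 ∧
        q.unpair.2.unpair.2.unpair.1 = k z.2 ∧
          ¬ ltCode (halfPowCode (i z.2)) q.unpair.2.unpair.2.unpair.2 :=
    (Primrec.eq.comp (primrec_runFor (ht.comp p) (ha.comp p) u) (Primrec.option_some.comp q)).and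
      ((Primrec.eq.comp (primrec_unpair_fst.comp q2) (hn.comp p)).and
        ((Primrec.eq.comp (primrec_unpair_fst.comp q22) (hk.comp p)).and
          (primrecPred_ltCode (primrec_halfPowCode.comp (hi.comp p))
            (primrec_unpair_snd.comp q22)).not))
  have h2 : PrimrecRel fun (u : ℕ) (x : α) => ∃ q < t x,
      runFor (t x) (a x) u = some q ∧ q.unpair.2.unpair.1 = n x ∧
        q.unpair.2.unpair.2.unpair.1 = k x ∧
          ¬ ltCode (halfPowCode (i x)) q.unpair.2.unpair.2.unpair.2 :=
    primrecPred_exists_lt (ht.comp Primrec.snd) h1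
  exact primrecPred_exists_lt ht h2

theorem primrecPred_shownLarge (j : ℕ) {t c s : α → ℕ} (ht : Primrec t) (hc : Primrec c)
    (hs : Primrec s) : PrimrecPred fun x => ShownLarge j (t x) (c x) (s x) := by
  have hm : Primrec fun x : α => Nat.pair 1 (Encodable.encode
      ((Denumerable.ofNat (List ℕ) (s x)).map (Nat.pair j))) :=
    Primrec₂.natPair.comp (Primrec.const 1) (Primrec.encode.comp
      (Primrec.list_map (primrec_ofNat_listNat.comp hs)
        (Primrec₂.natPair.comp (Primrec.const j) Primrec.snd).to₂))
  have p : Primrec fun z : ℕ × α => z.2 := Primrec.snd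
  have h : PrimrecRel fun (w : ℕ) (x : α) =>
      runFor (t x) (c x) (Nat.pair 1 (Encodable.encode
        ((Denumerable.ofNat (List ℕ) (s x)).map (Nat.pair j)))) = some w ∧
          ltCode (halfPowCode 0) w.unpair.1 :=
    (Primrec.eq.comp (primrec_runFor (ht.comp p) (hc.comp p) (hm.comp p))
      (Primrec.option_some.comp Primrec.fst)).and
        (primrecPred_ltCode (Primrec.const _) (primrec_unpair_fst.comp Primrec.fst))
  exact primrecPred_exists_lt ht h

theorem primrecPred_largeNear (j : ℕ) {t a c l k s : α → ℕ} (ht : Primrec t) (ha : Primrec a)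
    (hc : Primrec c) (hl : Primrec l) (hk : Primrec k) (hs : Primrec s) :
    PrimrecPred fun x => LargeNear j (t x) (a x) (c x) (l x) (k x) (s x) := by
  have hlist := primrec_ofNat_listNat.comp hs
  have hlen := Primrec.list_length.comp hlist
  have p : Primrec fun z : ℕ × α => z.2 := Primrec.snd
  have h : PrimrecRel fun (i : ℕ) (x : α) =>
      ShownClose (t x) (a x) ((Denumerable.ofNat (List ℕ) (s x)).getD i 0) (k x) i :=
    primrecPred_shownClose (ht.comp p) (ha.comp p)
      ((Primrec.list_getD 0).comp (hlist.comp p) Primrec.fst) (hk.comp p) Primrec.fst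
  exact (Primrec.nat_le.comp hlen hl).and
    ((primrecPred_shownLarge j ht hc hs).and (primrecPred_forall_lt hlen h))

theorem primrecRel_certified (j : ℕ) : PrimrecRel (Certified j) := by
  let β := (ℕ × ℕ × ℕ) × ℕ
  have y1 : Primrec fun x : β => x.1.1 := Primrec.fst.comp Primrec.fst
  have y2 : Primrec fun x : β => x.1.2.1 := Primrec.fst.comp (Primrec.snd.comp Primrec.fst)
  have y3 : Primrec fun x : β => x.1.2.2 := Primrec.snd.comp (Primrec.snd.comp Primrec.fst)
  have t : Primrec fun x : β => x.2 := Primrec.snd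
  have p4 : Primrec fun z : ℕ × ℕ × ℕ × β => z.2.2.2 :=
    Primrec.snd.comp (Primrec.snd.comp Primrec.snd)
  have h4 : PrimrecRel fun (s : ℕ) (z : ℕ × ℕ × β) =>
      LargeNear j z.2.2.2 z.2.2.1.1 z.2.2.1.2.2 z.2.1 z.1 s :=
    primrecPred_largeNear j (t.comp p4) (y1.comp p4) (y3.comp p4)
      (Primrec.fst.comp (Primrec.snd.comp Primrec.snd)) (Primrec.fst.comp Primrec.snd) Primrec.fst
  have h3 : PrimrecRel fun (k : ℕ) (z : ℕ × β) => ∃ s < z.2.2,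
      LargeNear j z.2.2 z.2.1.1 z.2.1.2.2 z.1 k s :=
    primrecPred_exists_lt (t.comp (Primrec.snd.comp Primrec.snd)) h4
  have hrun : Primrec fun z : ℕ × ℕ × β => runFor z.2.2.2 z.2.2.1.2.1 z.2.1 :=
    primrec_runFor (t.comp (Primrec.snd.comp Primrec.snd))
      (y2.comp (Primrec.snd.comp Primrec.snd)) (Primrec.fst.comp Primrec.snd)
  have h2 : PrimrecRel fun (v : ℕ) (z : ℕ × β) => runFor z.2.2 z.2.1.2.1 z.1 = some v ∧
      ∀ k ∈ Denumerable.ofNat (List ℕ) v, ∃ s < z.2.2,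
        LargeNear j z.2.2 z.2.1.1 z.2.1.2.2 z.1 k s :=
    (Primrec.eq.comp hrun (Primrec.option_some.comp Primrec.fst)).and
      (PrimrecRel.comp (PrimrecRel.forall_mem_list h3)
        (primrec_ofNat_listNat.comp Primrec.fst) Primrec.snd)
  have h1 : PrimrecRel fun (l : ℕ) (x : β) => ∃ v < x.2, runFor x.2 x.1.2.1 l = some v ∧
      ∀ k ∈ Denumerable.ofNat (List ℕ) v, ∃ s < x.2, LargeNear j x.2 x.1.1 x.1.2.2 l k s :=
    primrecPred_exists_lt (t.comp Primrec.snd) h2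
  exact primrecPred_exists_lt t h1

end Primrec

theorem ratOfNat_halfPowCode (i : ℕ) :
    ((ratOfNat (halfPowCode i) : ℚ) : ℝ) = (2 : ℝ)⁻¹ ^ (i + 1) := by
  have h : ((2 ^ (i + 1) - 1 : ℕ) : ℝ) + 1 = 2 ^ (i + 1) := by
    have : 2 ^ (i + 1) - 1 + 1 = 2 ^ (i + 1) := Nat.sub_add_cancel Nat.one_le_two_pow
    exact_mod_cast this
  simp only [ratOfNat, halfPowCode, Nat.unpair_pair]
  push_cast [h]
  simp

theorem mem_phi_of_runFor {t a n v : ℕ} (h : runFor t a n = some v) : v ∈ phi a n :=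
  Code.evaln_sound h

theorem eventually_runFor {a n v : ℕ} (h : v ∈ phi a n) :
    ∀ᶠ t in Filter.atTop, runFor t a n = some v := by
  obtain ⟨t₀, ht₀⟩ := Code.evaln_complete.1 h
  filter_upwards [Filter.eventually_ge_atTop t₀] with t ht
  exact Code.evaln_mono ht ht₀

/-! ### Distances shown by a name, and compactness -/

section Space

variable {X : Type*} [TopologicalSpace X] {Q : SpacePresentation X} {a : ℕ}

theorem ShownClose.dist_lt {t n k i : ℕ} (ha : Q.HasIndex a) (h : ShownClose t a n k i) :
    Q.d (Q.pt n) (Q.pt k) < (2 : ℝ)⁻¹ ^ (i + 1) := by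
  obtain ⟨f, hf, hname⟩ := ha
  obtain ⟨u, -, q, -, hq, rfl, rfl, hlt⟩ := h
  have hqf : q = f u := Part.mem_unique (mem_phi_of_runFor hq) (hf u)
  have hmem : quadOfNat q ∈ Q.diagram := by
    rw [hname]
    exact ⟨u, by rw [hqf]⟩
  rw [ltCode_iff, not_lt, ← Rat.cast_le (K := ℝ), ratOfNat_halfPowCode] at hlt
  exact hmem.2.trans_le hlt

theorem eventually_shownClose {n k i : ℕ} (ha : Q.HasIndex a)
    (h : Q.d (Q.pt n) (Q.pt k) < (2 : ℝ)⁻¹ ^ (i + 1)) :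
    ∀ᶠ t in Filter.atTop, ShownClose t a n k i := by
  obtain ⟨f, hf, hname⟩ := ha
  have hnonneg : 0 ≤ Q.d (Q.pt n) (Q.pt k) := @dist_nonneg _ Q.metric.toPseudoMetricSpace _ _
  -- The lower bound `-1` works even when the distance is `0`.
  have hmem : ((-1 : ℚ), n, k, ratOfNat (halfPowCode i)) ∈ Q.diagram := by
    refine ⟨?_, ?_⟩
    · push_cast
      linarith
    · simpa only [ratOfNat_halfPowCode] using h
  rw [hname] at hmem
  obtain ⟨u, hu⟩ := hmem
  simp only [quadOfNat, Prod.mk.injEq] at hu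
  obtain ⟨-, h1, h2, h3⟩ := hu
  filter_upwards [eventually_runFor (hf u), Filter.eventually_gt_atTop u,
    Filter.eventually_gt_atTop (f u)] with t ht htu htf
  refine ⟨u, htu, f u, htf, ht, h1, h2, ?_⟩
  rw [ltCode_iff, h3]
  exact lt_irrefl _

theorem exists_pt_dist_lt (Q : SpacePresentation X) (x : X) {ε : ℝ} (hε : 0 < ε) :
    ∃ n, Q.d (Q.pt n) x < ε := by
  obtain ⟨metric, rfl, -, pt, dense⟩ := Q
  let := metric
  obtain ⟨n, hn⟩ := dense.exists_dist_lt x hε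
  exact ⟨n, by rw [dist_comm] at hn; exact hn⟩

theorem SpacePresentation.d_comm (Q : SpacePresentation X) (x y : X) : Q.d x y = Q.d y x :=
  @dist_comm _ Q.metric.toPseudoMetricSpace x y

theorem SpacePresentation.d_triangle (Q : SpacePresentation X) (x y z : X) :
    Q.d x z ≤ Q.d x y + Q.d y z :=
  @dist_triangle _ Q.metric.toPseudoMetricSpace x y z

theorem exists_finite_cover [CompactSpace X] (Q : SpacePresentation X) (r : X → ℝ)
    (hr : ∀ x, 0 < r x) : ∃ T : Finset X, ∀ y, ∃ x ∈ T, Q.d x y < r x := by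
  obtain ⟨metric, rfl, -, pt, dense⟩ := Q
  let := metric
  obtain ⟨T, -, hT⟩ := isCompact_univ.elim_nhds_subcover (fun x => Metric.ball x (r x))
    fun x _ => Metric.ball_mem_nhds x (hr x)
  refine ⟨T, fun y => ?_⟩
  obtain ⟨x, hx, hy⟩ := Set.mem_iUnion₂.1 (hT (Set.mem_univ y))
  exact ⟨x, hx, by rw [Metric.mem_ball, dist_comm] at hy; exact hy⟩

end Space

/-! ### Soundness and existence of certificates -/

section Evaluation

variable {X : Type} [TopologicalSpace X] [CompactSpace X] {P : CStarPresentation C(X, ℂ)}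
  {Q : SpacePresentation X} {a b c j : ℕ} {f : ℕ → ℕ}

theorem isPointName_pair (hj : P.ratVec j = P.vec 0) {x : X} {h : ℕ → ℕ}
    (hh : ∀ k, Q.d (Q.pt (h k)) x < (2 : ℝ)⁻¹ ^ k) :
    IsPointName (prodDist Q) (prodPt P Q) (P.vec 0, x) fun i => Nat.pair j (h i) := by
  intro k
  simp only [prodDist, prodPt, Nat.unpair_pair, hj, sub_self, norm_zero]
  exact max_lt (by positivity) (hh k)

/-- A list that is close enough to `x` extends to a full name of `x`, so any output already given on
the list must be correct for `x`. -/
theorem dist_value_lt (hc : IsEvaluationIndex P Q c) (hj : P.ratVec j = P.vec 0) {x : X}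
    {σ : List ℕ} (hσ : ∀ i < σ.length, Q.d (Q.pt (σ.getD i 0)) x < (2 : ℝ)⁻¹ ^ i) {w : ℕ}
    (hw : w ∈ phi c (Nat.pair 1 (Encodable.encode (σ.map (Nat.pair j))))) :
    dist (cplxOfNat w) (P.vec 0 x) < 2⁻¹ := by
  choose g hg using fun i : ℕ => exists_pt_dist_lt Q x (ε := (2 : ℝ)⁻¹ ^ i) (by positivity)
  let h : ℕ → ℕ := fun i => if i < σ.length then σ.getD i 0 else g i
  have hh : ∀ i, Q.d (Q.pt (h i)) x < (2 : ℝ)⁻¹ ^ i := by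
    intro i
    by_cases hi : i < σ.length
    · simp only [h, if_pos hi]
      exact hσ i hi
    · simp only [h, if_neg hi]
      exact hg i
  have hseg : initSeg (fun i => Nat.pair j (h i)) σ.length = σ.map (Nat.pair j) := by
    refine List.ext_getElem (by simp [initSeg]) fun i h1 h2 => ?_
    have hi : i < σ.length := by simpa using h2
    simp [initSeg, h, hi]
  have := (hc (P.vec 0, x) _ (isPointName_pair hj hh) 1).2 σ.length w (by rw [hseg]; exact hw)
  simpa using this

/-- Certificates are sound. -/
theorem Certified.vec_apply_ne_zero {t : ℕ} (h : Certified j (a, b, c) t) (ha : Q.HasIndex a)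
    (hb : IsIndexOf b f) (hf : Q.IsTotalBoundednessFunction f) (hc : IsEvaluationIndex P Q c)
    (hj : P.ratVec j = P.vec 0) (x : X) : P.vec 0 x ≠ 0 := by
  intro hx
  obtain ⟨l, -, v, -, hv, hcov⟩ := h
  have hvf : v = f l := Part.mem_unique (mem_phi_of_runFor hv) (hb l)
  obtain ⟨k, hk, hxk⟩ := hf l x
  rw [← hvf] at hk
  obtain ⟨s, -, hlen, ⟨w, -, hw, hlt⟩, hclose⟩ := hcov k hk
  have hdist := dist_value_lt hc hj (x := x) (fun i hi => ?_) (mem_phi_of_runFor hw)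
  -- The output is within `1/2` of the value but has real part above `1/2`.
  · rw [hx, dist_zero_right] at hdist
    rw [ltCode_iff, ← Rat.cast_lt (K := ℝ), ratOfNat_halfPowCode] at hlt
    have hre : (cplxOfNat w).re = ratOfNat w.unpair.1 := by simp [cplxOfNat]
    have := Complex.re_le_norm (cplxOfNat w)
    rw [hre] at this
    norm_num at hlt hdist
    linarith
  -- Since `i < length ≤ l`, the errors add up to less than `2^{-(i+1)} + 2^{-l} ≤ 2^{-i}`, so the
  -- list begins a name of every point of the ball.
  · have h1 := (hclose i hi).dist_lt ha
    have h2 := Q.d_triangle (Q.pt ((Denumerable.ofNat (List ℕ) s).getD i 0)) (Q.pt k) x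
    rw [Q.d_comm (Q.pt k) x] at h2
    have h3 : (2 : ℝ)⁻¹ ^ l ≤ (2 : ℝ)⁻¹ ^ (i + 1) :=
      pow_le_pow_of_le_one (by norm_num) (by norm_num) (by omega)
    have h4 : (2 : ℝ)⁻¹ ^ (i + 1) = (2 : ℝ)⁻¹ ^ i / 2 := by rw [pow_succ]; ring
    linarith

/-- Near every point the evaluation machine confirms that a unit takes the value one. -/
theorem exists_list_large (hc : IsEvaluationIndex P Q c) (hj : P.ratVec j = P.vec 0)
    (hone : ∀ x, P.vec 0 x = 1) (x : X) :
    ∃ (σ : List ℕ) (w : ℕ), w ∈ phi c (Nat.pair 1 (Encodable.encode (σ.map (Nat.pair j)))) ∧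
      ltCode (halfPowCode 0) w.unpair.1 ∧
      ∀ i < σ.length, Q.d (Q.pt (σ.getD i 0)) x < (2 : ℝ)⁻¹ ^ (i + 2) := by
  -- A name with two spare binary digits leaves room for replacing `x` by a nearby special point.
  choose h hh using fun i : ℕ => exists_pt_dist_lt Q x (ε := (2 : ℝ)⁻¹ ^ (i + 2)) (by positivity)
  have hname : ∀ i, Q.d (Q.pt (h i)) x < (2 : ℝ)⁻¹ ^ i := fun i =>
    (hh i).trans_le (pow_le_pow_of_le_one (by norm_num) (by norm_num) (by omega))
  obtain ⟨⟨n, hn⟩, hval⟩ := hc (P.vec 0, x) _ (isPointName_pair hj hname) 1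
  obtain ⟨w, hw⟩ := Part.dom_iff_mem.1 hn
  have hdist := hval n w hw
  refine ⟨initSeg h n, w, ?_, ?_, fun i hi => ?_⟩
  · have : (initSeg h n).map (Nat.pair j) = initSeg (fun i => Nat.pair j (h i)) n := by
      simp [initSeg]
    rw [this]
    exact hw
  · rw [ltCode_iff, ← Rat.cast_lt (K := ℝ), ratOfNat_halfPowCode]
    have hre : (cplxOfNat w).re = ratOfNat w.unpair.1 := by simp [cplxOfNat]
    simp only [hone, dist_eq_norm] at hdist
    have := (Complex.abs_re_le_norm (cplxOfNat w - 1)).trans_lt hdist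
    rw [Complex.sub_re, Complex.one_re, hre, abs_lt] at this
    norm_num at this ⊢
    linarith
  · have hi' : i < n := by simpa [initSeg] using hi
    simpa [initSeg, hi'] using hh i

/-- If the first vector is the unit, then there is a certificate. -/
theorem exists_certified (ha : Q.HasIndex a)
    (hb : IsIndexOf b f) (hc : IsEvaluationIndex P Q c) (hj : P.ratVec j = P.vec 0)
    (hone : ∀ x, P.vec 0 x = 1) : ∃ t, Certified j (a, b, c) t := by
  choose σ w hw hlarge hclose using exists_list_large hc hj hone
  -- With this radius, a special point in the ball around `x` is within `2^{-(i+2)} + 2^{-(i+2)} =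
  -- 2^{-(i+1)}` of entry `i` of `σ x`.
  obtain ⟨T, hT⟩ := exists_finite_cover Q (fun x => (2 : ℝ)⁻¹ ^ ((σ x).length + 2))
    fun x => by positivity
  -- The scale `l` must bound the lengths of all the lists used.
  let l := T.sup fun x => (σ x).length
  have key : ∀ k, ∀ᶠ t in Filter.atTop, ∃ s < t, LargeNear j t a c l k s := by
    intro k
    obtain ⟨x, hxT, hx⟩ := hT (Q.pt k)
    have hall : ∀ᶠ t in Filter.atTop, ∀ i ∈ Finset.range (σ x).length,
        ShownClose t a ((σ x).getD i 0) k i := by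
      refine (Filter.eventually_all_finset _).2 fun i hi => ?_
      have hi' := Finset.mem_range.1 hi
      refine eventually_shownClose ha ?_
      have h1 := hclose x i hi'
      have h2 := Q.d_triangle (Q.pt ((σ x).getD i 0)) x (Q.pt k)
      have h3 : (2 : ℝ)⁻¹ ^ ((σ x).length + 2) ≤ (2 : ℝ)⁻¹ ^ (i + 2) :=
        pow_le_pow_of_le_one (by norm_num) (by norm_num) (by omega)
      have h4 : (2 : ℝ)⁻¹ ^ (i + 1) = 2 * (2 : ℝ)⁻¹ ^ (i + 2) := by rw [pow_succ _ (i + 1)]; ring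
      linarith
    filter_upwards [hall, eventually_runFor (hw x), Filter.eventually_gt_atTop (w x),
      Filter.eventually_gt_atTop (Encodable.encode (σ x))] with t h1 h2 h3 h4
    refine ⟨Encodable.encode (σ x), h4, ?_⟩
    simp only [LargeNear, ShownLarge, Denumerable.ofNat_encode]
    exact ⟨Finset.le_sup (f := fun x => (σ x).length) hxT, ⟨w x, h3, h2, hlarge x⟩,
      fun i hi => h1 i (Finset.mem_range.2 hi)⟩
  have hall : ∀ᶠ t in Filter.atTop, ∀ k ∈ (Denumerable.ofNat (List ℕ) (f l)).toFinset,
      ∃ s < t, LargeNear j t a c l k s := (Filter.eventually_all_finset _).2 fun k _ => key k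
  obtain ⟨t, h1, h2, h3, h4⟩ := (hall.and ((eventually_runFor (hb l)).and
    ((Filter.eventually_gt_atTop l).and (Filter.eventually_gt_atTop (f l))))).exists
  exact ⟨t, l, h3, f l, h4, h2, fun k hk => h1 k (List.mem_toFinset.2 hk)⟩

end Evaluation

/-- There is no algorithm for `C*(ℕ∞)`: it would make the complement of the halting problem
recursively enumerable. -/
theorem not_exists_isEvaluativeSpaceAlgorithm :
    ¬ ∃ ψ : ℕ →. ℕ × ℕ × ℕ, IsEvaluativeSpaceAlgorithm ℕ∞ ψ := by
  classical
  rintro ⟨ψ, hψ, halg⟩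
  obtain ⟨e, he, hloop, hhalt⟩ := exists_computable_index_family
  obtain ⟨j, hj⟩ := exists_ratVec_eq_vec_zero
  let search : ℕ × ℕ × ℕ →. ℕ := fun y => Nat.rfind fun t => Part.some (decide (Certified j y t))
  have hsearch : Partrec search :=
    Partrec.rfind ((PrimrecRel.decide (primrecRel_certified j)).to_comp.partrec₂)
  -- The domain of this composite will be exactly the set of machines that do not halt on `0`.
  have hre := (Partrec.bind (hψ.comp he) (hsearch.comp Computable.snd).to₂).dom_re
  refine ComputablePred.halting_problem_not_re 0 (hre.of_eq fun c => ?_)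
  rw [Part.dom_iff_mem]
  simp only [Part.mem_bind_iff]
  constructor
  · rintro ⟨t, y, hy, ht⟩ hc
    obtain ⟨P, hP, h0⟩ := hhalt c hc
    obtain ⟨a, b, d, habd, Q, ha, ⟨f, hb, hf⟩, hd⟩ := halg (e c) P hP
    obtain rfl := Part.mem_unique hy habd
    have hcert : Certified j (a, b, d) t := by simpa using Nat.rfind_spec ht
    exact hcert.vec_apply_ne_zero ha hb hf hd (hj P) 0 h0
  · intro hc
    obtain ⟨P, hP, h1⟩ := hloop c hc
    obtain ⟨a, b, d, habd, Q, ha, ⟨f, hb, hf⟩, hd⟩ := halg (e c) P hP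
    obtain ⟨t, ht⟩ := exists_certified ha hb hd (hj P) h1
    have hdom : (search (a, b, d)).Dom := Nat.rfind_dom.2 ⟨t, by simpa using ht, fun _ => trivial⟩
    obtain ⟨u, hu⟩ := Part.dom_iff_mem.1 hdom
    exact ⟨u, (a, b, d), habd, hu⟩

theorem polishSpace_enat : PolishSpace ℕ∞ := by
  let := TopologicalSpace.metrizableSpaceMetric ℕ∞
  infer_instance

end EvalPres

theorem corollary5p4 :
    ∃ (X : Type) (_ : TopologicalSpace X) (_ : CompactSpace X) (_ : PolishSpace X)
      (_ : Nonempty X),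
      ¬ ∃ ψ : ℕ →. ℕ × ℕ × ℕ, EvalPres.IsEvaluativeSpaceAlgorithm X ψ :=
  ⟨ℕ∞, inferInstance, inferInstance, EvalPres.polishSpace_enat, inferInstance,
    EvalPres.not_exists_isEvaluativeSpaceAlgorithm⟩
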